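/- Let $\mathcal X$ be a measurable space (of signals), let $\mathcal D^s$ and $\mathcal D^t$ be probability distributions on $\mathcal X$ (the source and the target domain), and let $f^s,f^t:\mathcal X\to\{0,1\}$ be the ground-truth label functions of the two domains. For $h,g:\mathcal X\to\{0,1\}$ put $$\epsilon^s(h,g)=\mathbb E_{X\sim\mathcal D^s}\big[\mathbb 1_{h(X)\ne g(X)}\big],\qquad \epsilon^t(h,g)=\mathbb E_{X\sim\mathcal D^t}\big[\mathbb 1_{h(X)\ne g(X)}\big].$$ Let $\mathcal H$ be a set of functions $\mathcal X\to\{0,1\}$ of finite VC dimension $d$ (the largest cardinality of a finite set of points on which every $\{0,1\}$-labelling is realised by a member of $\mathcal H$). All functions are measurable. Let $h^\star\in\mathcal H$ minimise $h\mapsto\epsilon^t(h,f^t)$ over $\mathcal H$. Let $N\ge 1$, let $\mathcal S=(x^s_1,\dots,x^s_N)$ be i.i.d. from $\mathcal D^s$ and $\mathcal T=(x^t_1,\dots,x^t_N)$ i.i.d. from $\mathcal D^t$, and put $$\hat\epsilon^s(h,g)=\frac1N\sum_{i=1}^N\mathbb 1_{h(x^s_i)\ne g(x^s_i)},\qquad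 \hat\epsilon^t(h,g)=\frac1N\sum_{i=1}^N\mathbb 1_{h(x^t_i)\ne g(x^t_i)},$$ $$d_{\mathcal H\Delta\mathcal H}(\mathcal S,\mathcal T)=2\sup_{h,h'\in\mathcal H}\big|\hat\epsilon^t(h,h')-\hat\epsilon^s(h,h')\big|.$$ Let $\mu\in(0,1)$. Then for every $\rho\in(0,1)$, with probability at least $1-\rho$ over the choice of the samples, the following holds for every pseudo-label function $\hat f^t:\mathcal X\to\{0,1\}$ (which may therefore depend on the samples) and every $\hat h\in\mathcal H$ that minimises the weighted risk $h\mapsto\mu\,\epsilon^s(h,f^s)+(1-\mu)\,\epsilon^t(h,\hat f^t)$ over $\mathcal H$: $$\epsilon^t(\hat h,f^t)-\epsilon^t(h^\star,f^t)\le \mu\, d_{\mathcal H\Delta\mathcal H}(\mathcal S,\mathcal T)+2(1+\mu)\,\epsilon^t(\hat f^t,f^t)+2\mu\Lambda,$$ where $$\Lambda=4\sqrt{\frac{2d\log(2N)+\log(2/\rho)}{N}}+\Lambda^\star,\qquad \Lambda^\star=\inf_{h\in\mathcal H}\big(\epsilon^s(h,f^s)+\epsilon^t(h,f^t)\big).$$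 -/

import Mathlib

open MeasureTheory ProbabilityTheory

noncomputable section

namespace DomainAdaptation

/-- The expected error probability `𝔼_{X ∼ D} [1_{h(X) ≠ g(X)}]` between two binary
label functions, with labels `{0, 1}`. -/
def risk {X : Type*} [MeasurableSpace X] (D : Measure X) (h g : X → Fin 2) : ℝ :=
  ∫ x, (if h x ≠ g x then (1 : ℝ) else 0) ∂D

/-- The empirical error `(1/N) ∑ᵢ 1_{h(xᵢ) ≠ g(xᵢ)}` on the sample `x = (x₁, …, x_N)`. -/
def empRisk {X : Type*} {N : ℕ} (x : Fin N → X) (h g : X → Fin 2) : ℝ :=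
  (1 / (N : ℝ)) * ∑ i, (if h (x i) ≠ g (x i) then (1 : ℝ) else 0)

/-- The weighted risk `μ ε^s(h, f^s) + (1 - μ) ε^t(h, f̂^t)`. -/
def jointRisk {X : Type*} [MeasurableSpace X] (Ds Dt : Measure X) (μ : ℝ)
    (fs fhat h : X → Fin 2) : ℝ :=
  μ * risk Ds h fs + (1 - μ) * risk Dt h fhat

/-- The class `H` shatters the finite set `A`: every labelling of the points of `A` is realised
by a member of `H`. -/
def Shatters {X : Type*} (H : Set (X → Fin 2)) (A : Finset X) : Prop :=
  ∀ c : X → Fin 2, ∃ h ∈ H, ∀ x ∈ A, h x = c x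

/-- The Vapnik–Chervonenkis dimension: the largest cardinality of a finite shattered set
(`⊤` if there are arbitrarily large ones). -/
def vcDim {X : Type*} (H : Set (X → Fin 2)) : ℕ∞ :=
  ⨆ (A : Finset X) (_ : Shatters H A), (A.card : ℕ∞)

/-- The empirical discrepancy
`d_{HΔH}(S, T) = 2 sup_{h, h' ∈ H} |ε̂^t(h, h') - ε̂^s(h, h')|` of two samples. -/
def discrepancy {X : Type*} {N : ℕ} (H : Set (X → Fin 2)) (S T : Fin N → X) : ℝ :=
  2 * ⨆ p : H × H, |empRisk T (p.1 : X → Fin 2) p.2 - empRisk S (p.1 : X → Fin 2) p.2|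

/-- The minimum combined error `Λ⋆ = min_{h ∈ H} (ε^s(h, f^s) + ε^t(h, f^t))`, written as an
infimum so that it makes sense also when it is not attained. -/
def lambdaStar {X : Type*} [MeasurableSpace X] (Ds Dt : Measure X) (H : Set (X → Fin 2))
    (fs ft : X → Fin 2) : ℝ :=
  ⨅ h : H, (risk Ds (h : X → Fin 2) fs + risk Dt (h : X → Fin 2) ft)

/-- `Λ = 4 √((2 d log (2N) + log (2/ρ)) / N) + Λ⋆`. -/
def lambdaTerm {X : Type*} [MeasurableSpace X] (Ds Dt : Measure X) (H : Set (X → Fin 2))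
    (fs ft : X → Fin 2) (d N : ℕ) (ρ : ℝ) : ℝ :=
  4 * √((2 * (d : ℝ) * Real.log (2 * (N : ℝ)) + Real.log (2 / ρ)) / (N : ℝ))
    + lambdaStar Ds Dt H fs ft

end DomainAdaptation

end

namespace DomainAdaptation

/-! ### Disagreement probability as a pseudometric -/

section Risk

/-! Only one direction of the comparison between true and empirical discrepancy is needed: an upper
bound for the true one. Fix, before sampling, a pair in `H` that nearly maximises the true
discrepancy (`exists_pair_abs_risk_sub_le`). Hoeffding's inequality for this single pair controls
its empirical value in both samples, and the empirical supremum dominates that value; no uniform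
convergence over `H` is involved. The rest is deterministic. By the triangle inequality for `risk`,
a bound `Δ` on the true discrepancy makes the weighted risk uniformly close to the target risk
(`abs_jointRisk_sub_risk_le`), so minimising one nearly minimises the other. The good event does not
involve the pseudo-labels, which may therefore depend on the samples. -/

lemma disagreement_mem_Icc {X : Type*} (h g : X → Fin 2) (x : X) :
    (if h x ≠ g x then (1 : ℝ) else 0) ∈ Set.Icc (0 : ℝ) 1 := by
  split_ifs <;> simp

variable {X : Type*} [MeasurableSpace X]

lemma measurable_disagreement {h g : X → Fin 2} (hh : Measurable h) (hg : Measurable g) :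
    Measurable fun x => if h x ≠ g x then (1 : ℝ) else 0 :=
  Measurable.ite (measurableSet_eq_fun hh hg).compl measurable_const measurable_const

lemma risk_nonneg (D : Measure X) (h g : X → Fin 2) : 0 ≤ risk D h g :=
  integral_nonneg fun x => (disagreement_mem_Icc h g x).1

lemma risk_comm (D : Measure X) (h g : X → Fin 2) : risk D h g = risk D g h := by
  simp only [risk, ne_comm]

variable (D : Measure X) [IsProbabilityMeasure D]

lemma integrable_disagreement {h g : X → Fin 2} (hh : Measurable h) (hg : Measurable g) :
    Integrable (fun x => if h x ≠ g x then (1 : ℝ) else 0) D :=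
  Integrable.of_mem_Icc 0 1 (measurable_disagreement hh hg).aemeasurable
    (ae_of_all _ (disagreement_mem_Icc h g))

lemma risk_le_one {h g : X → Fin 2} (hh : Measurable h) (hg : Measurable g) :
    risk D h g ≤ 1 := by
  have := integral_mono (integrable_disagreement D hh hg) (integrable_const (1 : ℝ))
    fun x => (disagreement_mem_Icc h g x).2
  simpa [risk] using this

lemma risk_triangle {f g h : X → Fin 2} (hf : Measurable f) (hg : Measurable g)
    (hh : Measurable h) : risk D f h ≤ risk D f g + risk D g h := by
  unfold risk
  rw [← integral_add (integrable_disagreement D hf hg) (integrable_disagreement D hg hh)]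
  refine integral_mono (integrable_disagreement D hf hh)
    ((integrable_disagreement D hf hg).add (integrable_disagreement D hg hh)) fun x => ?_
  by_cases h1 : f x = g x <;> by_cases h2 : g x = h x <;> by_cases h3 : f x = h x <;>
    simp_all

lemma abs_risk_sub_risk_le {f g h : X → Fin 2} (hf : Measurable f) (hg : Measurable g)
    (hh : Measurable h) : |risk D f g - risk D f h| ≤ risk D g h := by
  have h1 := risk_triangle D hf hh hg
  have h2 := risk_triangle D hf hg hh
  rw [risk_comm D h g] at h1
  rw [abs_le]
  constructor <;> linarith

end Risk

/-! ### Empirical risk and empirical discrepancy -/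

section Empirical

lemma empRisk_mem_Icc {X : Type*} {N : ℕ} (x : Fin N → X) (h g : X → Fin 2) :
    empRisk x h g ∈ Set.Icc (0 : ℝ) 1 := by
  have h0 : 0 ≤ ∑ i, (if h (x i) ≠ g (x i) then (1 : ℝ) else 0) :=
    Finset.sum_nonneg fun i _ => by split_ifs <;> simp
  have h1 : ∑ i, (if h (x i) ≠ g (x i) then (1 : ℝ) else 0) ≤ N := by
    calc _ ≤ ∑ _i : Fin N, (1 : ℝ) := Finset.sum_le_sum fun i _ => by split_ifs <;> simp
      _ = N := by simp
  refine ⟨by unfold empRisk; positivity, ?_⟩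
  rw [empRisk, one_div_mul_eq_div]
  exact div_le_one_of_le₀ h1 (Nat.cast_nonneg N)

lemma two_mul_abs_empRisk_sub_le_discrepancy {X : Type*} {N : ℕ} {H : Set (X → Fin 2)}
    (S T : Fin N → X) {h g : X → Fin 2} (hh : h ∈ H) (hg : g ∈ H) :
    2 * |empRisk T h g - empRisk S h g| ≤ discrepancy H S T := by
  -- A real supremum over an unbounded range defaults to 0, so boundedness must be supplied.
  have hbdd : BddAbove (Set.range fun p : H × H =>
      |empRisk T (p.1 : X → Fin 2) p.2 - empRisk S (p.1 : X → Fin 2) p.2|) := by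
    refine ⟨1, ?_⟩
    rintro _ ⟨p, rfl⟩
    have h1 := empRisk_mem_Icc T (p.1 : X → Fin 2) p.2
    have h2 := empRisk_mem_Icc S (p.1 : X → Fin 2) p.2
    rw [abs_le]
    constructor <;> linarith [h1.1, h1.2, h2.1, h2.2]
  exact mul_le_mul_of_nonneg_left
    (le_ciSup hbdd ((⟨h, hh⟩, ⟨g, hg⟩) : H × H)) zero_le_two

end Empirical

/-! ### Hoeffding bounds for a fixed pair -/

section Concentration

variable {Ω : Type*} [MeasurableSpace Ω] (P : Measure Ω) [IsProbabilityMeasure P]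

/-- **Hoeffding's inequality**, two-sided, for independent random variables in `[0, 1]` with
common mean `m`. -/
lemma hoeffding_abs_sum {N : ℕ} (hN : 0 < N) {Y : Fin N → Ω → ℝ}
    (hYm : ∀ i, Measurable (Y i)) (hY : ∀ i ω, Y i ω ∈ Set.Icc (0 : ℝ) 1)
    (hind : iIndepFun Y P) {m : ℝ} (hm : ∀ i, ∫ ω, Y i ω ∂P = m) {t : ℝ} (ht : 0 ≤ t) :
    P.real {ω | t ≤ |1 / (N : ℝ) * ∑ i, Y i ω - m|} ≤ 2 * Real.exp (-2 * N * t ^ 2) := by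
  have hN' : (0 : ℝ) < N := Nat.cast_pos.mpr hN
  have hsub : ∀ i, HasSubgaussianMGF (fun ω => Y i ω - m) ((‖(1 : ℝ) - 0‖₊ / 2) ^ 2) P := by
    intro i
    have := hasSubgaussianMGF_of_mem_Icc (hYm i).aemeasurable (ae_of_all P (hY i))
    rwa [hm i] at this
  have hind1 : iIndepFun (fun i ω => Y i ω - m) P :=
    hind.comp (fun _ y => y - m) fun _ => measurable_id.sub_const m
  have hind2 : iIndepFun (fun i => -fun ω => Y i ω - m) P :=
    hind.comp (fun _ y => -(y - m)) fun _ => (measurable_id.sub_const m).neg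
  have hNt : 0 ≤ (N : ℝ) * t := by positivity
  -- Each variable has variance proxy 1/4, so the sum has N/4.
  have hexp : -((N : ℝ) * t) ^ 2 /
      (2 * ((∑ _i : Fin N, (‖(1 : ℝ) - 0‖₊ / 2) ^ 2 : NNReal) : ℝ)) = -2 * N * t ^ 2 := by
    simp
    field_simp
  have b1 := HasSubgaussianMGF.measure_sum_ge_le_of_iIndepFun hind1 (s := Finset.univ)
    (fun i _ => hsub i) hNt
  have b2 := HasSubgaussianMGF.measure_sum_ge_le_of_iIndepFun hind2 (s := Finset.univ)
    (fun i _ => (hsub i).neg) hNt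
  rw [hexp] at b1 b2
  have hsum : ∀ ω, ∑ i, (Y i ω - m) = N * (1 / (N : ℝ) * ∑ i, Y i ω - m) := by
    intro ω
    rw [Finset.sum_sub_distrib]
    simp
    field_simp
  have hincl : {ω | t ≤ |1 / (N : ℝ) * ∑ i, Y i ω - m|} ⊆
      {ω | N * t ≤ ∑ i, (Y i ω - m)} ∪ {ω | N * t ≤ ∑ i, (-fun ω => Y i ω - m) ω} := by
    intro ω hω
    simp only [Set.mem_union, Set.mem_ofPred_eq, Pi.neg_apply, Finset.sum_neg_distrib, hsum,
      ← mul_neg, mul_le_mul_iff_right₀ hN'] at hω ⊢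
    exact le_abs.mp hω
  calc _ ≤ _ := measureReal_mono hincl
    _ ≤ _ := measureReal_union_le _ _
    _ ≤ _ := by linarith

variable {X : Type*} [MeasurableSpace X]

lemma measurable_empRisk {N : ℕ} {S : Fin N → Ω → X} (hSm : ∀ i, Measurable (S i))
    {h g : X → Fin 2} (hh : Measurable h) (hg : Measurable g) :
    Measurable fun ω => empRisk (fun i => S i ω) h g :=
  (Finset.measurable_sum _ fun i _ =>
    (measurable_disagreement hh hg).comp (hSm i)).const_mul _

lemma hoeffding_empRisk {D : Measure X} {N : ℕ} (hN : 0 < N) {S : Fin N → Ω → X}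
    (hSm : ∀ i, Measurable (S i)) (hSlaw : ∀ i, P.map (S i) = D) (hSind : iIndepFun S P)
    {h g : X → Fin 2} (hh : Measurable h) (hg : Measurable g) {t : ℝ} (ht : 0 ≤ t) :
    P.real {ω | t ≤ |empRisk (fun i => S i ω) h g - risk D h g|} ≤
      2 * Real.exp (-2 * N * t ^ 2) := by
  have hφ := measurable_disagreement hh hg
  refine hoeffding_abs_sum P hN (fun i => hφ.comp (hSm i))
    (fun i ω => disagreement_mem_Icc h g (S i ω)) (hSind.comp _ fun _ => hφ) (fun i => ?_) ht
  rw [risk, ← hSlaw i, integral_map (hSm i).aemeasurable hφ.aestronglyMeasurable]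
  rfl

/-- The deviation `√(log (2/ρ) / N)` is exceeded with probability at most `ρ / 2`. -/
lemma measureReal_sqrt_le_abs_empRisk_sub_risk {D : Measure X} {N : ℕ} (hN : 0 < N)
    {S : Fin N → Ω → X} (hSm : ∀ i, Measurable (S i)) (hSlaw : ∀ i, P.map (S i) = D)
    (hSind : iIndepFun S P) {h g : X → Fin 2} (hh : Measurable h) (hg : Measurable g)
    {ρ : ℝ} (hρ : ρ ∈ Set.Ioo (0 : ℝ) 1) :
    P.real {ω | √(Real.log (2 / ρ) / N) ≤ |empRisk (fun i => S i ω) h g - risk D h g|} ≤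
      ρ / 2 := by
  obtain ⟨hρ0, hρ1⟩ := hρ
  have hN' : (0 : ℝ) < N := Nat.cast_pos.mpr hN
  have hlog : 0 ≤ Real.log (2 / ρ) := Real.log_nonneg (by rw [le_div_iff₀ hρ0]; linarith)
  refine (hoeffding_empRisk P hN hSm hSlaw hSind hh hg (Real.sqrt_nonneg _)).trans ?_
  -- The Hoeffding bound becomes `2 * (ρ / 2) ^ 2`, which is at most `ρ / 2` because `ρ < 1`.
  have h1 : -2 * (N : ℝ) * √(Real.log (2 / ρ) / N) ^ 2 =
      Real.log (ρ / 2) + Real.log (ρ / 2) := by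
    rw [Real.sq_sqrt (by positivity), ← inv_div 2 ρ, Real.log_inv]
    field_simp
    ring
  rw [h1, Real.exp_add, Real.exp_log (by positivity)]
  nlinarith

end Concentration

/-! ### Deterministic excess-risk bound -/

section Excess

variable {X : Type*} [MeasurableSpace X] (Ds Dt : Measure X) [IsProbabilityMeasure Ds]
  [IsProbabilityMeasure Dt]

/-- A pair of hypotheses whose disagreement probabilities on the two domains are, up to `η`,
as far apart as possible. -/
lemma exists_pair_abs_risk_sub_le {H : Set (X → Fin 2)} (hne : H.Nonempty)
    (hH : ∀ h ∈ H, Measurable h) {η : ℝ} (hη : 0 < η) :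
    ∃ h₀ ∈ H, ∃ g₀ ∈ H, ∀ h ∈ H, ∀ g ∈ H,
      |risk Ds h g - risk Dt h g| ≤ |risk Ds h₀ g₀ - risk Dt h₀ g₀| + η := by
  have : Nonempty H := hne.to_subtype
  let F : H × H → ℝ := fun p => |risk Ds p.1.1 p.2.1 - risk Dt p.1.1 p.2.1|
  have hbdd : BddAbove (Set.range F) := by
    refine ⟨1, ?_⟩
    rintro _ ⟨⟨⟨h, hh⟩, ⟨g, hg⟩⟩, rfl⟩
    have hm := hH h hh
    have gm := hH g hg
    simp only [F]
    rw [abs_le]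
    constructor <;> linarith [risk_nonneg Ds h g, risk_nonneg Dt h g, risk_le_one Ds hm gm,
      risk_le_one Dt hm gm]
  obtain ⟨⟨⟨h₀, hh₀⟩, ⟨g₀, hg₀⟩⟩, h₀g₀⟩ := exists_lt_of_lt_ciSup (sub_lt_self (⨆ p, F p) hη)
  refine ⟨h₀, hh₀, g₀, hg₀, fun h hh g hg => ?_⟩
  have h1 := le_ciSup hbdd ((⟨h, hh⟩, ⟨g, hg⟩) : H × H)
  simp only [F] at h1 h₀g₀
  linarith

/-- For any `g ∈ H`, replacing `fs` and `ft` by `g` costs `risk Ds g fs + risk Dt g ft`, and the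
remaining difference is at most `Δ`. The infimum over `g` gives `lambdaStar`. -/
lemma abs_risk_sub_risk_le_lambdaStar {H : Set (X → Fin 2)} (hH : ∀ h ∈ H, Measurable h)
    {fs ft : X → Fin 2} (hfs : Measurable fs) (hft : Measurable ft) {Δ : ℝ}
    (hΔ : ∀ h ∈ H, ∀ g ∈ H, |risk Ds h g - risk Dt h g| ≤ Δ) {h : X → Fin 2} (hh : h ∈ H) :
    |risk Ds h fs - risk Dt h ft| ≤ Δ + lambdaStar Ds Dt H fs ft := by
  have : Nonempty H := ⟨⟨h, hh⟩⟩
  rw [← sub_le_iff_le_add']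
  refine le_ciInf fun ⟨g, hg⟩ => ?_
  have hm := hH h hh
  have gm := hH g hg
  have h1 := abs_le.mp (abs_risk_sub_risk_le Ds hm gm hfs)
  have h2 := abs_le.mp (abs_risk_sub_risk_le Dt hm gm hft)
  have h3 := abs_le.mp (hΔ h hh g hg)
  rw [sub_le_iff_le_add', abs_le]
  constructor <;> linarith [h1.1, h1.2, h2.1, h2.2, h3.1, h3.2]

lemma abs_jointRisk_sub_risk_le {H : Set (X → Fin 2)} (hH : ∀ h ∈ H, Measurable h)
    {fs ft fhat : X → Fin 2} (hfs : Measurable fs) (hft : Measurable ft)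
    (hfhat : Measurable fhat) {Δ : ℝ}
    (hΔ : ∀ h ∈ H, ∀ g ∈ H, |risk Ds h g - risk Dt h g| ≤ Δ) {μ : ℝ}
    (hμ : μ ∈ Set.Icc (0 : ℝ) 1) {h : X → Fin 2} (hh : h ∈ H) :
    |jointRisk Ds Dt μ fs fhat h - risk Dt h ft| ≤
      μ * (Δ + lambdaStar Ds Dt H fs ft) + (1 - μ) * risk Dt fhat ft := by
  have h1 := abs_risk_sub_risk_le_lambdaStar Ds Dt hH hfs hft hΔ hh
  have h2 := abs_risk_sub_risk_le Dt (hH h hh) hfhat hft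
  have hμ' : 0 ≤ 1 - μ := sub_nonneg.mpr hμ.2
  calc |jointRisk Ds Dt μ fs fhat h - risk Dt h ft|
      = |μ * (risk Ds h fs - risk Dt h ft) + (1 - μ) * (risk Dt h fhat - risk Dt h ft)| := by
        rw [jointRisk]; ring_nf
    _ ≤ μ * |risk Ds h fs - risk Dt h ft| + (1 - μ) * |risk Dt h fhat - risk Dt h ft| := by
        refine (abs_add_le _ _).trans_eq ?_
        rw [abs_mul, abs_mul, abs_of_nonneg hμ.1, abs_of_nonneg hμ']
    _ ≤ _ := add_le_add (mul_le_mul_of_nonneg_left h1 hμ.1) (mul_le_mul_of_nonneg_left h2 hμ')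

/-- The excess target risk of a minimiser of the weighted risk. -/
lemma risk_sub_risk_le_of_isMinOn_jointRisk {H : Set (X → Fin 2)} (hH : ∀ h ∈ H, Measurable h)
    {fs ft fhat : X → Fin 2} (hfs : Measurable fs) (hft : Measurable ft)
    (hfhat : Measurable fhat) {Δ : ℝ}
    (hΔ : ∀ h ∈ H, ∀ g ∈ H, |risk Ds h g - risk Dt h g| ≤ Δ) {μ : ℝ}
    (hμ : μ ∈ Set.Icc (0 : ℝ) 1) {hhat h : X → Fin 2} (hhat_mem : hhat ∈ H) (hh : h ∈ H)
    (hmin : IsMinOn (jointRisk Ds Dt μ fs fhat) H hhat) :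
    risk Dt hhat ft - risk Dt h ft ≤
      2 * μ * (Δ + lambdaStar Ds Dt H fs ft) + 2 * (1 - μ) * risk Dt fhat ft := by
  have h1 := abs_le.mp (abs_jointRisk_sub_risk_le Ds Dt hH hfs hft hfhat hΔ hμ hhat_mem)
  have h2 := abs_le.mp (abs_jointRisk_sub_risk_le Ds Dt hH hfs hft hfhat hΔ hμ hh)
  have h3 := isMinOn_iff.mp hmin h hh
  linarith [h1.1, h2.2]

end Excess

end DomainAdaptation

theorem theorem1 {X Ω : Type*} [MeasurableSpace X] [MeasurableSpace Ω]
    -- source and target domains, and their ground-truth label functions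
    (Ds Dt : Measure X) [IsProbabilityMeasure Ds] [IsProbabilityMeasure Dt]
    (fs ft : X → Fin 2) (hfs : Measurable fs) (hft : Measurable ft)
    -- hypothesis space of VC dimension `d`
    (H : Set (X → Fin 2)) (hH : ∀ h ∈ H, Measurable h)
    (d : ℕ) (hd : DomainAdaptation.vcDim H = d)
    -- i.i.d. samples of size `N` from the two domains
    (N : ℕ) (hN : 0 < N)
    (P : Measure Ω) [IsProbabilityMeasure P]
    (S T : Fin N → Ω → X)
    (hSm : ∀ i, Measurable (S i)) (hTm : ∀ i, Measurable (T i))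
    (hSlaw : ∀ i, P.map (S i) = Ds) (hTlaw : ∀ i, P.map (T i) = Dt)
    (hSind : iIndepFun S P) (hTind : iIndepFun T P)
    -- an optimal model on the target domain
    (hstar : X → Fin 2) (hstar_mem : hstar ∈ H)
    (hstar_min : IsMinOn (fun h => DomainAdaptation.risk Dt h ft) H hstar)
    (μ : ℝ) (hμ : μ ∈ Set.Ioo (0 : ℝ) 1) (ρ : ℝ) (hρ : ρ ∈ Set.Ioo (0 : ℝ) 1) :
    ∃ G : Set Ω, MeasurableSet G ∧ 1 - ρ ≤ P.real G ∧
      ∀ ω ∈ G, ∀ fhat : X → Fin 2, Measurable fhat →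
        ∀ hhat ∈ H, IsMinOn (DomainAdaptation.jointRisk Ds Dt μ fs fhat) H hhat →
          DomainAdaptation.risk Dt hhat ft - DomainAdaptation.risk Dt hstar ft ≤
            μ * DomainAdaptation.discrepancy H (fun i => S i ω) (fun i => T i ω)
              + 2 * (1 + μ) * DomainAdaptation.risk Dt fhat ft
              + 2 * μ * DomainAdaptation.lambdaTerm Ds Dt H fs ft d N ρ := by
  obtain ⟨hρ0, hρ1⟩ := hρ
  obtain ⟨hμ0, hμ1⟩ := hμ
  have hN' : (0 : ℝ) < N := Nat.cast_pos.mpr hN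
  have hlog : 0 < Real.log (2 / ρ) := Real.log_pos (by rw [lt_div_iff₀ hρ0]; linarith)
  have hlogN : 0 ≤ Real.log (2 * (N : ℝ)) :=
    Real.log_nonneg (by linarith [Nat.one_le_cast (α := ℝ).mpr hN])
  set t := √(Real.log (2 / ρ) / N) with ht
  have ht0 : 0 < t := Real.sqrt_pos.mpr (by positivity)
  have htL : t ≤ √((2 * (d : ℝ) * Real.log (2 * (N : ℝ)) + Real.log (2 / ρ)) / (N : ℝ)) := by
    refine Real.sqrt_le_sqrt (div_le_div_of_nonneg_right ?_ hN'.le)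
    have : 0 ≤ 2 * (d : ℝ) * Real.log (2 * (N : ℝ)) := by positivity
    linarith
  obtain ⟨h₀, hh₀, g₀, hg₀, hsup⟩ := DomainAdaptation.exists_pair_abs_risk_sub_le Ds Dt
    ⟨hstar, hstar_mem⟩ hH (mul_pos two_pos ht0)
  have hm := hH h₀ hh₀
  have gm := hH g₀ hg₀
  -- The bad events concern one fixed pair, so they are measurable even when `H` is uncountable.
  let BS := {ω | t ≤ |DomainAdaptation.empRisk (fun i => S i ω) h₀ g₀ -
    DomainAdaptation.risk Ds h₀ g₀|}
  let BT := {ω | t ≤ |DomainAdaptation.empRisk (fun i => T i ω) h₀ g₀ -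
    DomainAdaptation.risk Dt h₀ g₀|}
  have hBS : P.real BS ≤ ρ / 2 := DomainAdaptation.measureReal_sqrt_le_abs_empRisk_sub_risk P hN
    hSm hSlaw hSind hm gm ⟨hρ0, hρ1⟩
  have hBT : P.real BT ≤ ρ / 2 := DomainAdaptation.measureReal_sqrt_le_abs_empRisk_sub_risk P hN
    hTm hTlaw hTind hm gm ⟨hρ0, hρ1⟩
  have hmS : MeasurableSet BS := measurableSet_le measurable_const
    ((DomainAdaptation.measurable_empRisk hSm hm gm).sub_const _).abs
  have hmT : MeasurableSet BT := measurableSet_le measurable_const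
    ((DomainAdaptation.measurable_empRisk hTm hm gm).sub_const _).abs
  refine ⟨(BS ∪ BT)ᶜ, (hmS.union hmT).compl, ?_, ?_⟩
  · rw [probReal_compl_eq_one_sub (hmS.union hmT)]
    linarith [measureReal_union_le (μ := P) BS BT]
  · intro ω hω fhat hfhat hhat hhat_mem hmin
    simp only [BS, BT, Set.mem_compl_iff, Set.mem_union, Set.mem_ofPred_eq, not_or, not_le,
      abs_lt] at hω
    obtain ⟨⟨hS1, hS2⟩, hT1, hT2⟩ := hω
    have hdisc := DomainAdaptation.two_mul_abs_empRisk_sub_le_discrepancy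
      (fun i => S i ω) (fun i => T i ω) hh₀ hg₀
    have hpair : |DomainAdaptation.risk Ds h₀ g₀ - DomainAdaptation.risk Dt h₀ g₀| ≤
        DomainAdaptation.discrepancy H (fun i => S i ω) (fun i => T i ω) / 2 + 2 * t := by
      have h1 := abs_le.mp ((le_div_iff₀' two_pos).mpr hdisc)
      rw [abs_le]
      constructor <;> linarith [h1.1, h1.2]
    -- The constant 4 splits as `2 * t` for the two sample deviations and `2 * t` for the
    -- near-maximality of the pair, with `t` then enlarged by `htL`.
    have hΔ : ∀ h ∈ H, ∀ g ∈ H, |DomainAdaptation.risk Ds h g - DomainAdaptation.risk Dt h g| ≤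
        DomainAdaptation.discrepancy H (fun i => S i ω) (fun i => T i ω) / 2 +
          4 * √((2 * (d : ℝ) * Real.log (2 * (N : ℝ)) + Real.log (2 / ρ)) / (N : ℝ)) :=
      fun h hh g hg => by linarith [hsup h hh g hg]
    have hmain := DomainAdaptation.risk_sub_risk_le_of_isMinOn_jointRisk Ds Dt hH hfs hft hfhat
      hΔ ⟨hμ0.le, hμ1.le⟩ hhat_mem hstar_mem hmin
    -- This relaxes the coefficient `2 * (1 - μ)` of `hmain` to `2 * (1 + μ)`.
    have hnn : 0 ≤ μ * DomainAdaptation.risk Dt fhat ft :=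
      mul_nonneg hμ0.le (DomainAdaptation.risk_nonneg Dt fhat ft)
    rw [DomainAdaptation.lambdaTerm]
    linarith
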